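/- Let $\lambda,\mu\in(0,1)$. For $B\in\{1,2,\dots\}\cup\{\infty\}$, the \emph{reference chain} with buffer size $B$ is the Markov chain $L^B(t)$ on $\{0,1,\dots,B\}$ (on $\{0,1,2,\dots\}$ if $B=\infty$) with the following one-step dynamics: from state $i$, the next state is $$\min\bigl(B,\;K+A\bigr),\qquad K\sim\mathrm{Binom}\bigl(\max(0,i-S),\,1-\mu\bigr)\ \text{ given } S,$$ where $S,A\sim\mathrm{Bernoulli}(\lambda)$, and $A$ is independent of $(S,K)$, i.e. $$P^B_{ij}=\sum_{s=0}^1\sum_{a=0}^1\mathbb P(S=s)\,\mathbb P(A=a)\sum_{k=0}^{\max(0,i-s)}\binom{\max(0,i-s)}{k}(1-\mu)^k\mu^{\max(0,i-s)-k}\,\mathbf 1\{j=\min(B,k+a)\}.$$ For every $B\in\{1,2,\dots\}\cup\{\infty\}$ this chain has a unique stationary distribution $\pi^B$. Put $C^B:=1-\pi^B_0$ (and $C^\infty:=1-\pi^\infty_0$). Then there exist constants $\theta>0$ and $M<\infty$, depending on $(\lambda,\mu)$ but not on $B$, such that $$0\le C^\infty-C^B\le M e^{-\theta B}\qquad\text{for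 all integers } B\ge 1.$$ In particular $C^B\uparrow C^\infty$ as $B\to\infty$: $C^{B_1}\le C^{B_2}$ whenever $1\le B_1\le B_2$, and $C^B\to C^\infty$. -/

import Mathlib

open Filter Topology

noncomputable section

/-- Probability weight of `s ∈ {0, 1}` under the Bernoulli law with success probability `q`. -/
def bernoulliWeight (q : ℝ) (s : ℕ) : ℝ := if s = 1 then q else 1 - q

/-- One-step transition probability from `i` to `j` of the single-node reference chain with
entanglement generation probability `lam`, service attempt probability `lam`, decoherence
probability `mu` and buffer size `B` (`B = ⊤` is the infinite buffer).
In one slot: service `s` leaves `max (0, i - s)` entanglements (this is the truncated subtraction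
`i - s` of natural numbers), of which `k ~ Binom (i - s, 1 - mu)` survive decoherence; then `a`
arrivals occur and the new state is `min (B, k + a)`. -/
def refTransition (lam mu : ℝ) (B : ℕ∞) (i j : ℕ) : ℝ :=
  ∑ s ∈ Finset.range 2, ∑ a ∈ Finset.range 2,
    bernoulliWeight lam s * bernoulliWeight lam a *
      ∑ k ∈ Finset.range (i - s + 1),
        ((i - s).choose k : ℝ) * (1 - mu) ^ k * mu ^ (i - s - k) *
          (if (j : ℕ∞) = min B ((k + a : ℕ) : ℕ∞) then 1 else 0)

/-- `ν` is a stationary distribution of the reference chain with buffer size `B`, whose state space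
is `{j : ℕ | j ≤ B}`; distributions on it are regarded as functions on `ℕ` vanishing beyond `B`. -/
structure IsRefStationary (lam mu : ℝ) (B : ℕ∞) (ν : ℕ → ℝ) : Prop where
  nonneg : ∀ i, 0 ≤ ν i
  support : ∀ i : ℕ, B < (i : ℕ∞) → ν i = 0
  hasSum_one : HasSum ν 1
  balance : ∀ j, HasSum (fun i => ν i * refTransition lam mu B i j) (ν j)

/-- The stationary distribution of the reference chain with buffer size `B`
(meaningful when it exists and is unique). -/
def stationaryDist (lam mu : ℝ) (B : ℕ∞) : ℕ → ℝ :=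
  Classical.epsilon (IsRefStationary lam mu B)

/-- The steady-state availability `1 - π₀` of the reference chain with buffer size `B`. -/
def availability (lam mu : ℝ) (B : ℕ∞) : ℝ := 1 - stationaryDist lam mu B 0

end

/-! Let `P_B` be the Markov operator `refOperator lam mu B` acting on functions. Service and
truncation do not expand distances, while thinning contracts them by `1 - mu`; hence `P_B`
multiplies Lipschitz constants by at most `1 - mu` (`abs_refOperator_succ_sub_le`). So `P_B ^ n f`
converges pointwise to a constant, `refLimit`, for every Lipschitz `f`.

Exponential moments of the chain started at `0` are bounded uniformly in `n` and `B`
(`refOperator_pow_powers_le`). This tightness makes the limits of the point indicators a stationary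
law, and dominated convergence under any stationary law shows that it is the only one.

Monotonicity in `B` is stochastic monotonicity applied to the antitone indicator of `0`. For the
rate, one step of `P_⊤` and of `P_B` differ only beyond level `B`, where the moment bound with base
`2` gives a factor `2 ^ (-B)`. The one-step errors telescope and, by the contraction, add up
geometrically (`abs_refOperator_pow_top_sub_le`). -/

/-- The Markov operator of binomial thinning: each of `n` items survives with probability
`1 - mu`. -/
noncomputable def binomialThinning (mu : ℝ) : (ℕ → ℝ) →ₗ[ℝ] (ℕ → ℝ) where
  toFun f n := ∑ k ∈ Finset.range (n + 1), (n.choose k : ℝ) * (1 - mu) ^ k * mu ^ (n - k) * f k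
  map_add' f g := by
    ext n
    simp only [Pi.add_apply, mul_add, Finset.sum_add_distrib]
  map_smul' c f := by
    ext n
    simp only [Pi.smul_apply, smul_eq_mul, RingHom.id_apply, Finset.mul_sum]
    exact Finset.sum_congr rfl fun k _ => by ring

/-- Truncation of a natural number at the level `B`. -/
noncomputable def truncate (B : ℕ∞) (m : ℕ) : ℕ := (min B (m : ℕ∞)).toNat

/-- The Markov operator of the reference chain with buffer size `B`. -/
noncomputable def refOperator (lam mu : ℝ) (B : ℕ∞) : (ℕ → ℝ) →ₗ[ℝ] (ℕ → ℝ) :=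
  ∑ s ∈ Finset.range 2, ∑ a ∈ Finset.range 2,
    (bernoulliWeight lam s * bernoulliWeight lam a) •
      (LinearMap.funLeft ℝ ℝ (fun i : ℕ => i - s) ∘ₗ binomialThinning mu ∘ₗ
        LinearMap.funLeft ℝ ℝ (fun k : ℕ => truncate B (k + a)))

/-! ### Truncation -/

theorem coe_truncate (B : ℕ∞) (m : ℕ) : (truncate B m : ℕ∞) = min B (m : ℕ∞) :=
  ENat.natCast_toNat (ne_top_of_le_ne_top (ENat.natCast_ne_top m) (min_le_right _ _))

theorem coe_eq_min_iff (B : ℕ∞) (j m : ℕ) : (j : ℕ∞) = min B (m : ℕ∞) ↔ truncate B m = j := by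
  rw [← coe_truncate, Nat.cast_inj, eq_comm]

theorem truncate_le (B : ℕ∞) (m : ℕ) : truncate B m ≤ m := by
  have h : (truncate B m : ℕ∞) ≤ m := (coe_truncate B m).trans_le (min_le_right _ _)
  exact_mod_cast h

theorem coe_truncate_le (B : ℕ∞) (m : ℕ) : (truncate B m : ℕ∞) ≤ B :=
  (coe_truncate B m).trans_le (min_le_left _ _)

theorem truncate_top (m : ℕ) : truncate ⊤ m = m := by simp [truncate]

theorem truncate_natCast (B m : ℕ) : truncate (B : ℕ∞) m = min B m := by
  have h : (truncate B m : ℕ∞) = (min B m : ℕ) := by rw [coe_truncate]; norm_cast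
  exact_mod_cast h

theorem truncate_mono_left {B₁ B₂ : ℕ∞} (h : B₁ ≤ B₂) (m : ℕ) :
    truncate B₁ m ≤ truncate B₂ m := by
  have : (truncate B₁ m : ℕ∞) ≤ truncate B₂ m := by
    rw [coe_truncate, coe_truncate]
    exact min_le_min_right _ h
  exact_mod_cast this

theorem truncate_succ (B : ℕ∞) (m : ℕ) :
    truncate B (m + 1) = truncate B m ∨ truncate B (m + 1) = truncate B m + 1 := by
  induction B using ENat.recTopCoe with
  | top => simp [truncate_top]
  | coe B => rw [truncate_natCast, truncate_natCast]; omega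

/-! ### Binomial thinning -/

section Thinning

variable {mu : ℝ}

theorem binomialThinning_apply (mu : ℝ) (f : ℕ → ℝ) (n : ℕ) :
    binomialThinning mu f n =
      ∑ k ∈ Finset.range (n + 1), (n.choose k : ℝ) * (1 - mu) ^ k * mu ^ (n - k) * f k := rfl

theorem binomialThinning_mono (h0 : 0 ≤ mu) (h1 : mu ≤ 1) : Monotone (binomialThinning mu) := by
  intro f g hfg n
  have := sub_nonneg.2 h1
  rw [binomialThinning_apply, binomialThinning_apply]
  exact Finset.sum_le_sum fun k _ => mul_le_mul_of_nonneg_left (hfg k) (by positivity)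

theorem binomialThinning_pow (mu y : ℝ) (n : ℕ) :
    binomialThinning mu (fun k => y ^ k) n = (1 + (1 - mu) * (y - 1)) ^ n := by
  have h : 1 + (1 - mu) * (y - 1) = (1 - mu) * y + mu := by ring
  rw [h, add_pow, binomialThinning_apply]
  exact Finset.sum_congr rfl fun k _ => by rw [mul_pow]; ring

theorem binomialThinning_const (mu c : ℝ) :
    binomialThinning mu (fun _ => c) = fun _ => c := by
  have h1 : binomialThinning mu (fun _ => 1) = fun _ => 1 := by
    ext n
    simpa using binomialThinning_pow mu 1 n
  have hc : (fun _ : ℕ => c) = c • fun _ : ℕ => (1 : ℝ) := by ext; simp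
  rw [hc, map_smul, h1]

theorem binomialThinning_zero_right (mu : ℝ) (f : ℕ → ℝ) : binomialThinning mu f 0 = f 0 := by
  simp [binomialThinning_apply]

/-- Condition on the extra item: it survives with probability `1 - mu`, independently of the others,
and then raises the count by one. -/
theorem binomialThinning_succ_sub (mu : ℝ) (f : ℕ → ℝ) (n : ℕ) :
    binomialThinning mu f (n + 1) - binomialThinning mu f n =
      (1 - mu) * binomialThinning mu (fun k => f (k + 1) - f k) n := by
  have h := Finset.sum_choose_succ_mul (R := ℝ)
    (fun k l => (1 - mu) ^ k * mu ^ l * f k) n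
  simp only [binomialThinning_apply, mul_assoc] at h ⊢
  rw [h, ← Finset.sum_add_distrib, ← Finset.sum_sub_distrib, Finset.mul_sum]
  refine Finset.sum_congr rfl fun k hk => ?_
  rw [Nat.succ_sub (Finset.mem_range_succ_iff.1 hk), pow_succ, pow_succ]
  ring

theorem abs_binomialThinning_succ_sub_le (h0 : 0 ≤ mu) (h1 : mu ≤ 1) {f : ℕ → ℝ} {c : ℝ}
    (hf : ∀ m, |f (m + 1) - f m| ≤ c) (n : ℕ) :
    |binomialThinning mu f (n + 1) - binomialThinning mu f n| ≤ (1 - mu) * c := by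
  rw [binomialThinning_succ_sub, abs_mul, abs_of_nonneg (sub_nonneg.2 h1)]
  refine mul_le_mul_of_nonneg_left (abs_le.2 ⟨?_, ?_⟩) (sub_nonneg.2 h1)
  · have := binomialThinning_mono h0 h1
      (show (fun _ => -c) ≤ fun k => f (k + 1) - f k from fun k => (abs_le.1 (hf k)).1) n
    simpa only [binomialThinning_const] using this
  · have := binomialThinning_mono h0 h1
      (show (fun k => f (k + 1) - f k) ≤ fun _ => c from fun k => (abs_le.1 (hf k)).2) n
    simpa only [binomialThinning_const] using this

theorem binomialThinning_antitone (h0 : 0 ≤ mu) (h1 : mu ≤ 1) {f : ℕ → ℝ} (hf : Antitone f) :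
    Antitone (binomialThinning mu f) := by
  refine antitone_nat_of_succ_le fun n => ?_
  have := binomialThinning_mono h0 h1
    (show (fun k => f (k + 1) - f k) ≤ fun _ => 0 from fun k => sub_nonpos.2 (hf k.le_succ)) n
  rw [binomialThinning_const] at this
  have := binomialThinning_succ_sub mu f n
  nlinarith

end Thinning

/-! ### The Markov operator -/

theorem sum_bernoulliWeight (q : ℝ) : ∑ s ∈ Finset.range 2, bernoulliWeight q s = 1 := by
  simp [Finset.sum_range_succ, bernoulliWeight]

theorem bernoulliWeight_nonneg {q : ℝ} (h0 : 0 ≤ q) (h1 : q ≤ 1) (s : ℕ) :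
    0 ≤ bernoulliWeight q s := by
  rw [bernoulliWeight]
  split_ifs <;> linarith

section Operator

variable {lam mu : ℝ}

theorem refOperator_apply (lam mu : ℝ) (B : ℕ∞) (f : ℕ → ℝ) (i : ℕ) :
    refOperator lam mu B f i = ∑ s ∈ Finset.range 2, ∑ a ∈ Finset.range 2,
      bernoulliWeight lam s * bernoulliWeight lam a *
        binomialThinning mu (fun k => f (truncate B (k + a))) (i - s) := by
  simp only [refOperator, LinearMap.sum_apply, Finset.sum_apply, LinearMap.smul_apply,
    Pi.smul_apply, smul_eq_mul]
  rfl

theorem refOperator_single (lam mu : ℝ) (B : ℕ∞) (i j : ℕ) :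
    refOperator lam mu B (Pi.single j 1) i = refTransition lam mu B i j := by
  simp only [refOperator_apply, refTransition, binomialThinning_apply, coe_eq_min_iff,
    Pi.single_apply]

/-- Averages with the weights of a service and an arrival are monotone. -/
theorem sum_bernoulliWeight_mul_le (h0 : 0 ≤ lam) (h1 : lam ≤ 1) {u v : ℕ → ℕ → ℝ}
    (h : ∀ s a, u s a ≤ v s a) :
    ∑ s ∈ Finset.range 2, ∑ a ∈ Finset.range 2,
        bernoulliWeight lam s * bernoulliWeight lam a * u s a ≤
      ∑ s ∈ Finset.range 2, ∑ a ∈ Finset.range 2,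
        bernoulliWeight lam s * bernoulliWeight lam a * v s a :=
  Finset.sum_le_sum fun s _ => Finset.sum_le_sum fun a _ =>
    mul_le_mul_of_nonneg_left (h s a)
      (mul_nonneg (bernoulliWeight_nonneg h0 h1 s) (bernoulliWeight_nonneg h0 h1 a))

theorem sum_bernoulliWeight_mul_const (lam c : ℝ) :
    ∑ s ∈ Finset.range 2, ∑ a ∈ Finset.range 2,
      bernoulliWeight lam s * bernoulliWeight lam a * c = c := by
  simp only [← Finset.sum_mul, ← Finset.mul_sum, sum_bernoulliWeight, one_mul]

theorem abs_sum_bernoulliWeight_mul_le (h0 : 0 ≤ lam) (h1 : lam ≤ 1) {u : ℕ → ℕ → ℝ} {c : ℝ}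
    (h : ∀ s a, |u s a| ≤ c) :
    |∑ s ∈ Finset.range 2, ∑ a ∈ Finset.range 2,
        bernoulliWeight lam s * bernoulliWeight lam a * u s a| ≤ c := by
  refine abs_le.2 ⟨?_, ?_⟩
  · rw [← sum_bernoulliWeight_mul_const lam (-c)]
    exact sum_bernoulliWeight_mul_le h0 h1 fun s a => (abs_le.1 (h s a)).1
  · conv_rhs => rw [← sum_bernoulliWeight_mul_const lam c]
    exact sum_bernoulliWeight_mul_le h0 h1 fun s a => (abs_le.1 (h s a)).2

theorem refOperator_const (lam mu : ℝ) (B : ℕ∞) (c : ℝ) :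
    refOperator lam mu B (fun _ => c) = fun _ => c := by
  ext i
  simp only [refOperator_apply, binomialThinning_const, sum_bernoulliWeight_mul_const]

theorem refOperator_pow_const (lam mu : ℝ) (B : ℕ∞) (c : ℝ) (n : ℕ) :
    (refOperator lam mu B ^ n) (fun _ => c) = fun _ => c := by
  induction n with
  | zero => rfl
  | succ n ih => rw [pow_succ, Module.End.mul_apply, refOperator_const, ih]

theorem refOperator_mono (hlam : lam ∈ Set.Ioo (0 : ℝ) 1) (hmu : mu ∈ Set.Ioo (0 : ℝ) 1)
    (B : ℕ∞) : Monotone (refOperator lam mu B) := by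
  intro f g hfg i
  simp only [refOperator_apply]
  exact sum_bernoulliWeight_mul_le hlam.1.le hlam.2.le fun s a =>
    binomialThinning_mono hmu.1.le hmu.2.le (fun k => hfg _) _

theorem refOperator_pow_mono (hlam : lam ∈ Set.Ioo (0 : ℝ) 1) (hmu : mu ∈ Set.Ioo (0 : ℝ) 1)
    (B : ℕ∞) (n : ℕ) : Monotone (refOperator lam mu B ^ n) := by
  rw [Module.End.coe_pow]
  exact (refOperator_mono hlam hmu B).iterate n

/-! ### Contraction of Lipschitz constants and convergence of the iterates -/

theorem abs_refOperator_succ_sub_le (hlam : lam ∈ Set.Ioo (0 : ℝ) 1)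
    (hmu : mu ∈ Set.Ioo (0 : ℝ) 1) (B : ℕ∞) {f : ℕ → ℝ} {c : ℝ} (hf : ∀ m, |f (m + 1) - f m| ≤ c)
    (i : ℕ) :
    |refOperator lam mu B f (i + 1) - refOperator lam mu B f i| ≤ (1 - mu) * c := by
  have hc : 0 ≤ c := (abs_nonneg _).trans (hf 0)
  have hmu' := sub_nonneg.2 hmu.2.le
  simp only [refOperator_apply, ← Finset.sum_sub_distrib, ← mul_sub]
  refine abs_sum_bernoulliWeight_mul_le hlam.1.le hlam.2.le fun s a => ?_
  have hstep : i + 1 - s = i - s ∨ i + 1 - s = i - s + 1 := by omega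
  rcases hstep with h | h
  · rw [h, sub_self, abs_zero]
    positivity
  · rw [h]
    refine abs_binomialThinning_succ_sub_le hmu.1.le hmu.2.le (fun m => ?_) _
    rw [add_right_comm]
    rcases truncate_succ B (m + a) with h | h
    · rw [h, sub_self, abs_zero]
      exact hc
    · rw [h]
      exact hf _

theorem abs_refOperator_pow_succ_sub_le (hlam : lam ∈ Set.Ioo (0 : ℝ) 1)
    (hmu : mu ∈ Set.Ioo (0 : ℝ) 1) (B : ℕ∞) {f : ℕ → ℝ} {c : ℝ}
    (hf : ∀ m, |f (m + 1) - f m| ≤ c) (n i : ℕ) :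
    |(refOperator lam mu B ^ n) f (i + 1) - (refOperator lam mu B ^ n) f i| ≤
      c * (1 - mu) ^ n := by
  induction n generalizing i with
  | zero => simpa using hf i
  | succ n ih =>
    rw [pow_succ', Module.End.mul_apply]
    exact (abs_refOperator_succ_sub_le hlam hmu B ih i).trans_eq (by ring)

theorem abs_sub_le_of_abs_succ_sub_le {f : ℕ → ℝ} {c : ℝ} (hf : ∀ m, |f (m + 1) - f m| ≤ c)
    {i j : ℕ} (hij : i ≤ j) : |f j - f i| ≤ c * ((j : ℝ) - i) := by
  induction j, hij using Nat.le_induction with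
  | base => simp
  | succ j _ ih =>
    have := abs_sub_le (f (j + 1)) (f j) (f i)
    push_cast
    linarith [hf j]

/-- From `0` nothing is served or lost, so one step moves the chain by at most one arrival. Applied
to the `n`-th iterate of `f`, this bounds consecutive iterates at `0`. -/
theorem abs_refOperator_zero_sub_le (hlam : lam ∈ Set.Ioo (0 : ℝ) 1) (B : ℕ∞)
    {f : ℕ → ℝ} {c : ℝ} (hf : ∀ m, |f (m + 1) - f m| ≤ c) :
    |refOperator lam mu B f 0 - f 0| ≤ c := by
  have hc : 0 ≤ c := (abs_nonneg _).trans (hf 0)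
  have h0 : truncate B 0 = 0 := Nat.le_zero.1 (truncate_le B 0)
  have h1 : |f (truncate B 1) - f 0| ≤ c := by
    rcases truncate_succ B 0 with h | h <;> rw [zero_add, h0] at h <;> rw [h]
    · simpa using hc
    · exact hf 0
  have key : refOperator lam mu B f 0 - f 0 = lam * (f (truncate B 1) - f 0) := by
    simp only [refOperator_apply, zero_tsub, binomialThinning_zero_right, Finset.sum_range_succ,
      Finset.sum_range_zero, bernoulliWeight, h0]
    norm_num [h0]
    ring
  rw [key, abs_mul, abs_of_pos hlam.1]
  nlinarith [hlam.2, abs_nonneg (f (truncate B 1) - f 0)]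

/-- The limit of the expectations of `f` along the reference chain started at `0`. -/
noncomputable def refLimit (lam mu : ℝ) (B : ℕ∞) (f : ℕ → ℝ) : ℝ :=
  limUnder atTop fun n => (refOperator lam mu B ^ n) f 0

theorem tendsto_refOperator_pow_zero (hlam : lam ∈ Set.Ioo (0 : ℝ) 1)
    (hmu : mu ∈ Set.Ioo (0 : ℝ) 1) (B : ℕ∞) {f : ℕ → ℝ} {c : ℝ}
    (hf : ∀ m, |f (m + 1) - f m| ≤ c) :
    Tendsto (fun n => (refOperator lam mu B ^ n) f 0) atTop (𝓝 (refLimit lam mu B f)) := by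
  refine CauchySeq.tendsto_limUnder
    (cauchySeq_of_le_geometric (1 - mu) c (by linarith [hmu.1]) fun n => ?_)
  rw [dist_comm, Real.dist_eq, pow_succ', Module.End.mul_apply]
  exact abs_refOperator_zero_sub_le hlam B (abs_refOperator_pow_succ_sub_le hlam hmu B hf n)

theorem tendsto_refOperator_pow (hlam : lam ∈ Set.Ioo (0 : ℝ) 1)
    (hmu : mu ∈ Set.Ioo (0 : ℝ) 1) (B : ℕ∞) {f : ℕ → ℝ} {c : ℝ}
    (hf : ∀ m, |f (m + 1) - f m| ≤ c) (i : ℕ) :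
    Tendsto (fun n => (refOperator lam mu B ^ n) f i) atTop (𝓝 (refLimit lam mu B f)) := by
  have h : Tendsto (fun n => (refOperator lam mu B ^ n) f i - (refOperator lam mu B ^ n) f 0)
      atTop (𝓝 0) := by
    refine squeeze_zero_norm (a := fun n => c * (1 - mu) ^ n * ((i : ℝ) - (0 : ℕ)))
      (fun n => abs_sub_le_of_abs_succ_sub_le
        (abs_refOperator_pow_succ_sub_le hlam hmu B hf n) (Nat.zero_le i)) ?_
    simpa using ((tendsto_pow_atTop_nhds_zero_of_lt_one (sub_nonneg.2 hmu.2.le)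
      (by linarith [hmu.1])).const_mul c).mul_const ((i : ℝ) - (0 : ℕ))
  simpa using h.add (tendsto_refOperator_pow_zero hlam hmu B hf)

/-! ### Exponential moments -/

theorem refOperator_powers_le (hlam : lam ∈ Set.Ioo (0 : ℝ) 1)
    (hmu : mu ∈ Set.Ioo (0 : ℝ) 1) (B : ℕ∞) {y : ℝ} (hy : 1 ≤ y) (i : ℕ) :
    refOperator lam mu B (fun k => y ^ k) i ≤
      (1 + lam * (y - 1)) * (1 + (1 - mu) * (y - 1)) ^ i := by
  have hz : 1 ≤ 1 + (1 - mu) * (y - 1) := by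
    nlinarith [mul_nonneg (sub_nonneg.2 hmu.2.le) (sub_nonneg.2 hy)]
  have hb (s a : ℕ) : binomialThinning mu (fun k => y ^ truncate B (k + a)) (i - s) ≤
      y ^ a * (1 + (1 - mu) * (y - 1)) ^ i := by
    calc binomialThinning mu (fun k => y ^ truncate B (k + a)) (i - s)
        ≤ binomialThinning mu (y ^ a • fun k => y ^ k) (i - s) := by
          refine binomialThinning_mono hmu.1.le hmu.2.le (fun k => ?_) _
          rw [Pi.smul_apply, smul_eq_mul, ← pow_add, add_comm a]
          exact pow_le_pow_right₀ hy (truncate_le _ _)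
      _ = y ^ a * (1 + (1 - mu) * (y - 1)) ^ (i - s) := by
          rw [map_smul, Pi.smul_apply, binomialThinning_pow, smul_eq_mul]
      _ ≤ y ^ a * (1 + (1 - mu) * (y - 1)) ^ i := by
          gcongr
          exact Nat.sub_le _ _
  rw [refOperator_apply]
  refine (sum_bernoulliWeight_mul_le hlam.1.le hlam.2.le hb).trans_eq ?_
  simp only [Finset.sum_range_succ, Finset.sum_range_zero, bernoulliWeight]
  norm_num
  ring

/-- Each step shrinks `y - 1` by the factor `1 - mu` at the cost of `exp (lam * (y - 1))`; the
geometric series yields the generating function of a Poisson law of mean `lam / mu`. -/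
theorem refOperator_pow_powers_le (hlam : lam ∈ Set.Ioo (0 : ℝ) 1)
    (hmu : mu ∈ Set.Ioo (0 : ℝ) 1) (B : ℕ∞) (n : ℕ) {y : ℝ} (hy : 1 ≤ y) :
    (refOperator lam mu B ^ n) (fun k => y ^ k) 0 ≤ Real.exp (lam * (y - 1) / mu) := by
  have hmu0 := hmu.1
  induction n generalizing y with
  | zero =>
    have := mul_nonneg hlam.1.le (sub_nonneg.2 hy)
    simpa using by positivity
  | succ n ih =>
    have hz : 1 ≤ 1 + (1 - mu) * (y - 1) := by
      nlinarith [mul_nonneg (sub_nonneg.2 hmu.2.le) (sub_nonneg.2 hy)]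
    have hnonneg := refOperator_pow_mono hlam hmu B n (a := fun _ => (0 : ℝ))
      (b := fun k => (1 + (1 - mu) * (y - 1)) ^ k) (fun k => by positivity) 0
    rw [refOperator_pow_const] at hnonneg
    rw [pow_succ, Module.End.mul_apply]
    calc (refOperator lam mu B ^ n) (refOperator lam mu B fun k => y ^ k) 0
        ≤ (refOperator lam mu B ^ n)
            ((1 + lam * (y - 1)) • fun k => (1 + (1 - mu) * (y - 1)) ^ k) 0 :=
          refOperator_pow_mono hlam hmu B n (fun i => refOperator_powers_le hlam hmu B hy i) 0
      _ ≤ Real.exp (lam * (y - 1)) *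
            Real.exp (lam * (1 + (1 - mu) * (y - 1) - 1) / mu) := by
          rw [map_smul, Pi.smul_apply, smul_eq_mul]
          have h1 := Real.add_one_le_exp (lam * (y - 1))
          exact mul_le_mul (by linarith) (ih hz)
            hnonneg (Real.exp_pos _).le
      _ = Real.exp (lam * (y - 1) / mu) := by
          rw [← Real.exp_add]
          congr 1
          field_simp
          ring

/-- Integration against the `n`-step transition probabilities is the `n`-th power of the Markov
operator. -/
theorem hasSum_refOperator_pow_single_mul (lam mu : ℝ) (B : ℕ∞) (g : ℕ → ℝ) (n i : ℕ) :
    HasSum (fun j => (refOperator lam mu B ^ n) (Pi.single j 1) i * g j)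
      ((refOperator lam mu B ^ n) g i) := by
  induction n generalizing i with
  | zero =>
    convert hasSum_ite_eq i (g i) using 2 with j
    · rw [pow_zero, Module.End.one_apply, Pi.single_apply]
      split_ifs <;> simp_all
    · rw [pow_zero, Module.End.one_apply]
  | succ n ih =>
    simp only [pow_succ', Module.End.mul_apply]
    simp only [refOperator_apply lam mu B, binomialThinning_apply, Finset.sum_mul, Finset.mul_sum]
    -- Each state has finitely many successors, so only finite combinations of the inductive sums
    -- occur.
    refine hasSum_sum fun s _ => hasSum_sum fun a _ => hasSum_sum fun k _ => ?_
    simp only [mul_assoc]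
    exact ((((((ih _).mul_left _).mul_left _).mul_left _).mul_left _).mul_left _)

theorem hasSum_refTransition_mul (lam mu : ℝ) (B : ℕ∞) (g : ℕ → ℝ) (i : ℕ) :
    HasSum (fun j => refTransition lam mu B i j * g j) (refOperator lam mu B g i) := by
  simpa only [pow_one, refOperator_single] using
    hasSum_refOperator_pow_single_mul lam mu B g 1 i

theorem abs_single_succ_sub_le (j m : ℕ) :
    |(Pi.single j 1 : ℕ → ℝ) (m + 1) - (Pi.single j 1 : ℕ → ℝ) m| ≤ 1 := by
  simp only [Pi.single_apply]
  split_ifs <;> norm_num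

/-! ### Existence and uniqueness of the stationary distribution -/

theorem refTransition_nonneg (hlam : lam ∈ Set.Ioo (0 : ℝ) 1) (hmu : mu ∈ Set.Ioo (0 : ℝ) 1)
    (B : ℕ∞) (i j : ℕ) : 0 ≤ refTransition lam mu B i j := by
  have := refOperator_mono hlam hmu B
    (show (fun _ => (0 : ℝ)) ≤ Pi.single j 1 from
      Pi.single_nonneg (α := fun _ : ℕ => ℝ).2 zero_le_one) i
  rwa [refOperator_const, refOperator_single] at this

theorem refOperator_pow_single_nonneg (hlam : lam ∈ Set.Ioo (0 : ℝ) 1)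
    (hmu : mu ∈ Set.Ioo (0 : ℝ) 1) (B : ℕ∞) (n i j : ℕ) :
    0 ≤ (refOperator lam mu B ^ n) (Pi.single j 1) i := by
  have := refOperator_pow_mono hlam hmu B n
    (show (fun _ => (0 : ℝ)) ≤ Pi.single j 1 from
      Pi.single_nonneg (α := fun _ : ℕ => ℝ).2 zero_le_one) i
  rwa [refOperator_pow_const] at this

/-- Markov's inequality for the moment with base `2`; the bound is summable in `j` and free of `n`,
as dominated convergence requires. -/
theorem refOperator_pow_single_le (hlam : lam ∈ Set.Ioo (0 : ℝ) 1)
    (hmu : mu ∈ Set.Ioo (0 : ℝ) 1) (B : ℕ∞) (n j : ℕ) :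
    (refOperator lam mu B ^ n) (Pi.single j 1) 0 ≤ (1 / 2) ^ j * Real.exp (lam / mu) := by
  have h : (Pi.single j 1 : ℕ → ℝ) ≤ ((1 / 2 : ℝ) ^ j) • fun k => (2 : ℝ) ^ k := by
    intro k
    rw [Pi.single_apply, Pi.smul_apply, smul_eq_mul]
    split_ifs with hk
    · rw [hk, ← mul_pow]
      norm_num
    · positivity
  refine (refOperator_pow_mono hlam hmu B n h 0).trans ?_
  rw [map_smul, Pi.smul_apply, smul_eq_mul]
  have h2 := refOperator_pow_powers_le hlam hmu B n (y := 2) (by norm_num)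
  rw [show lam * ((2 : ℝ) - 1) / mu = lam / mu by ring] at h2
  gcongr

/-- Dominated convergence along the law of the reference chain started at `0`. -/
theorem tendsto_refOperator_pow_tsum (hlam : lam ∈ Set.Ioo (0 : ℝ) 1)
    (hmu : mu ∈ Set.Ioo (0 : ℝ) 1) (B : ℕ∞) {g : ℕ → ℝ} (hg : ∀ i, |g i| ≤ 1) :
    Summable (fun i => refLimit lam mu B (Pi.single i 1) * g i) ∧
    Tendsto (fun n => (refOperator lam mu B ^ n) g 0) atTop
      (𝓝 (∑' i, refLimit lam mu B (Pi.single i 1) * g i)) := by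
  have hbound : Summable fun i : ℕ => (1 / 2 : ℝ) ^ i * Real.exp (lam / mu) :=
    summable_geometric_two.mul_right _
  have hlim (i : ℕ) := tendsto_refOperator_pow_zero hlam hmu B (abs_single_succ_sub_le i)
  have hle (n i : ℕ) : ‖(refOperator lam mu B ^ n) (Pi.single i 1) 0 * g i‖ ≤
      (1 / 2 : ℝ) ^ i * Real.exp (lam / mu) := by
    rw [norm_mul, Real.norm_of_nonneg (refOperator_pow_single_nonneg hlam hmu B n 0 i)]
    exact (mul_le_of_le_one_right (refOperator_pow_single_nonneg hlam hmu B n 0 i) (hg i)).trans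
      (refOperator_pow_single_le hlam hmu B n i)
  refine ⟨hbound.of_norm_bounded fun i =>
    le_of_tendsto' ((hlim i).mul_const (g i)).norm fun n => hle n i, ?_⟩
  have := tendsto_tsum_of_dominated_convergence hbound
    (fun i => (hlim i).mul_const (g i)) (Eventually.of_forall fun n i => hle n i)
  simpa only [(hasSum_refOperator_pow_single_mul lam mu B g _ 0).tsum_eq] using this

theorem isRefStationary_refLimit (hlam : lam ∈ Set.Ioo (0 : ℝ) 1)
    (hmu : mu ∈ Set.Ioo (0 : ℝ) 1) (B : ℕ∞) :
    IsRefStationary lam mu B fun j => refLimit lam mu B (Pi.single j 1) := by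
  have hlim (i : ℕ) := tendsto_refOperator_pow_zero hlam hmu B (abs_single_succ_sub_le i)
  have hsum {g : ℕ → ℝ} (hg : ∀ i, |g i| ≤ 1) {x : ℝ}
      (hx : Tendsto (fun n => (refOperator lam mu B ^ n) g 0) atTop (𝓝 x)) :
      HasSum (fun i => refLimit lam mu B (Pi.single i 1) * g i) x := by
    obtain ⟨h1, h2⟩ := tendsto_refOperator_pow_tsum hlam hmu B hg
    rw [tendsto_nhds_unique hx h2]
    exact h1.hasSum
  refine ⟨fun i => ge_of_tendsto' (hlim i) fun n =>
    refOperator_pow_single_nonneg hlam hmu B n 0 i, fun i hi => ?_, ?_, fun j => ?_⟩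
  -- The shift by one matters: a single step already kills the indicator of a state beyond the
  -- buffer.
  · refine tendsto_nhds_unique ((tendsto_add_atTop_iff_nat 1).2 (hlim i)) ?_
    have hzero : refOperator lam mu B (Pi.single i 1) = 0 := by
      ext k
      have htr (m : ℕ) : truncate B m ≠ i := by
        rintro rfl
        exact absurd (coe_truncate_le B m) (not_le.2 hi)
      simp [refOperator_apply, binomialThinning_apply, htr]
    simp only [pow_succ, Module.End.mul_apply, hzero, map_zero, Pi.zero_apply]
    exact tendsto_const_nhds
  · have := hsum (g := fun _ => 1) (by simp) (x := 1)
      (by simp only [refOperator_pow_const]; exact tendsto_const_nhds)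
    simpa using this
  · refine hsum (fun i => ?_) ?_
    · have h := refOperator_mono hlam hmu B
        (show (Pi.single j 1 : ℕ → ℝ) ≤ fun _ => 1 from fun k => by
          rw [Pi.single_apply]; split_ifs <;> norm_num) i
      rw [refOperator_const, refOperator_single] at h
      rwa [abs_of_nonneg (refTransition_nonneg hlam hmu B i j)]
    · have h : (fun i => refTransition lam mu B i j) = refOperator lam mu B (Pi.single j 1) :=
        funext fun i => (refOperator_single lam mu B i j).symm
      simp only [h, ← Module.End.mul_apply, ← pow_succ]
      exact (tendsto_add_atTop_iff_nat 1).2 (hlim j)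

theorem abs_refOperator_pow_le (hlam : lam ∈ Set.Ioo (0 : ℝ) 1) (hmu : mu ∈ Set.Ioo (0 : ℝ) 1)
    (B : ℕ∞) {f : ℕ → ℝ} {c : ℝ} (hf : ∀ i, |f i| ≤ c) (n i : ℕ) :
    |(refOperator lam mu B ^ n) f i| ≤ c := by
  refine abs_le.2 ⟨?_, ?_⟩
  · simpa only [refOperator_pow_const] using refOperator_pow_mono hlam hmu B n
      (show (fun _ => -c) ≤ f from fun k => (abs_le.1 (hf k)).1) i
  · simpa only [refOperator_pow_const] using refOperator_pow_mono hlam hmu B n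
      (show f ≤ fun _ => c from fun k => (abs_le.1 (hf k)).2) i

/-- Balance is tested on points only; Fubini extends it to bounded functions, since the joint
weights of two successive states are summable. -/
theorem IsRefStationary.tsum_mul_refOperator {B : ℕ∞} {ν : ℕ → ℝ}
    (hν : IsRefStationary lam mu B ν) (hlam : lam ∈ Set.Ioo (0 : ℝ) 1)
    (hmu : mu ∈ Set.Ioo (0 : ℝ) 1) {f : ℕ → ℝ} (hf : ∀ i, |f i| ≤ 1) :
    ∑' i, ν i * refOperator lam mu B f i = ∑' i, ν i * f i := by
  have hrow (i : ℕ) : HasSum (fun j => ν i * refTransition lam mu B i j) (ν i) := by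
    have := (hasSum_refTransition_mul lam mu B (fun _ => 1) i).mul_left (ν i)
    simpa [refOperator_const] using this
  have hnonneg (p : ℕ × ℕ) : 0 ≤ ν p.1 * refTransition lam mu B p.1 p.2 :=
    mul_nonneg (hν.nonneg _) (refTransition_nonneg hlam hmu B _ _)
  have hF : Summable fun p : ℕ × ℕ => ν p.1 * refTransition lam mu B p.1 p.2 := by
    refine (summable_prod_of_nonneg hnonneg).2 ⟨fun i => (hrow i).summable, ?_⟩
    simpa only [(hrow _).tsum_eq] using hν.hasSum_one.summable
  have hG : Summable (Function.uncurry fun i j => ν i * refTransition lam mu B i j * f j) := by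
    refine hF.of_norm_bounded fun p => ?_
    rw [Function.uncurry, norm_mul, Real.norm_of_nonneg (hnonneg p)]
    exact mul_le_of_le_one_right (hnonneg p) (hf _)
  have hcomm := hG.tsum_comm
  have h1 (i : ℕ) : ∑' j, ν i * refTransition lam mu B i j * f j =
      ν i * refOperator lam mu B f i := by
    simpa only [mul_assoc] using ((hasSum_refTransition_mul lam mu B f i).mul_left (ν i)).tsum_eq
  have h2 (j : ℕ) : ∑' i, ν i * refTransition lam mu B i j * f j = ν j * f j :=
    ((hν.balance j).mul_right (f j)).tsum_eq
  simp only [h1, h2] at hcomm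
  exact hcomm.symm

/-- The `ν`-mean of the iterates is constantly `ν j`, while the iterates tend to a constant function
and `ν` has mass one. -/
theorem IsRefStationary.eq_refLimit {B : ℕ∞} {ν : ℕ → ℝ}
    (hν : IsRefStationary lam mu B ν) (hlam : lam ∈ Set.Ioo (0 : ℝ) 1)
    (hmu : mu ∈ Set.Ioo (0 : ℝ) 1) (j : ℕ) : ν j = refLimit lam mu B (Pi.single j 1) := by
  have hbd (i : ℕ) : |(Pi.single j 1 : ℕ → ℝ) i| ≤ 1 := by
    rw [Pi.single_apply]
    split_ifs <;> norm_num
  have hconst (n : ℕ) : ∑' i, ν i * (refOperator lam mu B ^ n) (Pi.single j 1) i = ν j := by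
    induction n with
    | zero =>
      rw [tsum_eq_single j fun i hi => by simp [hi]]
      simp
    | succ n ih =>
      rw [← ih, pow_succ', Module.End.mul_apply]
      exact hν.tsum_mul_refOperator hlam hmu (abs_refOperator_pow_le hlam hmu B hbd n)
  have hlim : Tendsto (fun n => ∑' i, ν i * (refOperator lam mu B ^ n) (Pi.single j 1) i) atTop
      (𝓝 (∑' i, ν i * refLimit lam mu B (Pi.single j 1))) := by
    refine tendsto_tsum_of_dominated_convergence hν.hasSum_one.summable
      (fun i => (tendsto_refOperator_pow hlam hmu B (abs_single_succ_sub_le j) i).const_mul (ν i))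
      (Eventually.of_forall fun n i => ?_)
    rw [norm_mul, Real.norm_of_nonneg (hν.nonneg i)]
    exact mul_le_of_le_one_right (hν.nonneg i) (abs_refOperator_pow_le hlam hmu B hbd n i)
  simp only [hconst, tsum_mul_right, hν.hasSum_one.tsum_eq, one_mul] at hlim
  exact tendsto_nhds_unique tendsto_const_nhds hlim

theorem availability_eq (hlam : lam ∈ Set.Ioo (0 : ℝ) 1) (hmu : mu ∈ Set.Ioo (0 : ℝ) 1)
    (B : ℕ∞) : availability lam mu B = 1 - refLimit lam mu B (Pi.single 0 1) := by
  have h : IsRefStationary lam mu B (stationaryDist lam mu B) :=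
    Classical.epsilon_spec ⟨_, isRefStationary_refLimit hlam hmu B⟩
  rw [availability, h.eq_refLimit hlam hmu]

/-! ### Dependence on the buffer size -/

/-- Service, thinning, arrival and truncation all preserve the order of states. This lets the
one-step comparison of two buffers be iterated. -/
theorem refOperator_antitone (hlam : lam ∈ Set.Ioo (0 : ℝ) 1) (hmu : mu ∈ Set.Ioo (0 : ℝ) 1)
    (B : ℕ∞) {f : ℕ → ℝ} (hf : Antitone f) : Antitone (refOperator lam mu B f) := by
  intro i j hij
  simp only [refOperator_apply]
  refine sum_bernoulliWeight_mul_le hlam.1.le hlam.2.le fun s a => ?_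
  have hanti : Antitone fun k => f (truncate B (k + a)) := antitone_nat_of_succ_le fun k => hf <| by
    rw [add_right_comm]
    rcases truncate_succ B (k + a) with h | h <;> omega
  exact binomialThinning_antitone hmu.1.le hmu.2.le hanti (Nat.sub_le_sub_right hij s)

theorem refOperator_le_of_antitone (hlam : lam ∈ Set.Ioo (0 : ℝ) 1)
    (hmu : mu ∈ Set.Ioo (0 : ℝ) 1) {B₁ B₂ : ℕ∞} (hB : B₁ ≤ B₂) {f : ℕ → ℝ} (hf : Antitone f) :
    refOperator lam mu B₂ f ≤ refOperator lam mu B₁ f := by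
  intro i
  simp only [refOperator_apply]
  exact sum_bernoulliWeight_mul_le hlam.1.le hlam.2.le fun s a =>
    binomialThinning_mono hmu.1.le hmu.2.le (fun k => hf (truncate_mono_left hB _)) _

theorem refOperator_pow_le_of_antitone (hlam : lam ∈ Set.Ioo (0 : ℝ) 1)
    (hmu : mu ∈ Set.Ioo (0 : ℝ) 1) {B₁ B₂ : ℕ∞} (hB : B₁ ≤ B₂) (n : ℕ) {f : ℕ → ℝ}
    (hf : Antitone f) :
    (refOperator lam mu B₂ ^ n) f ≤ (refOperator lam mu B₁ ^ n) f := by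
  induction n generalizing f with
  | zero => exact le_rfl
  | succ n ih =>
    rw [pow_succ, pow_succ, Module.End.mul_apply, Module.End.mul_apply]
    exact (refOperator_pow_mono hlam hmu B₂ n (refOperator_le_of_antitone hlam hmu hB hf)).trans
      (ih (refOperator_antitone hlam hmu B₁ hf))

theorem availability_mono (hlam : lam ∈ Set.Ioo (0 : ℝ) 1) (hmu : mu ∈ Set.Ioo (0 : ℝ) 1) :
    Monotone (availability lam mu) := by
  intro B₁ B₂ hB
  rw [availability_eq hlam hmu, availability_eq hlam hmu]
  have hanti : Antitone (Pi.single 0 1 : ℕ → ℝ) := by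
    intro i j hij
    simp only [Pi.single_apply]
    split_ifs
    · exact le_rfl
    · omega
    · exact zero_le_one
    · exact le_rfl
  exact sub_le_sub_left (le_of_tendsto_of_tendsto'
    (tendsto_refOperator_pow_zero hlam hmu B₂ (abs_single_succ_sub_le 0))
    (tendsto_refOperator_pow_zero hlam hmu B₁ (abs_single_succ_sub_le 0))
    fun n => refOperator_pow_le_of_antitone hlam hmu hB n hanti 0) 1

/-! ### Exponential rate in the buffer size -/

theorem abs_refOperator_top_sub_le (hlam : lam ∈ Set.Ioo (0 : ℝ) 1)
    (hmu : mu ∈ Set.Ioo (0 : ℝ) 1) (B : ℕ) {f : ℕ → ℝ} {c : ℝ}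
    (hf : ∀ m, |f (m + 1) - f m| ≤ c) (i : ℕ) :
    |refOperator lam mu ⊤ f i - refOperator lam mu B f i| ≤
      refOperator lam mu ⊤ ((c * (1 / 2) ^ B) • fun k => (2 : ℝ) ^ k) i := by
  have hc : 0 ≤ c := (abs_nonneg _).trans (hf 0)
  -- The overflow `m - B` is at most `2 ^ (m - B)`, a multiple of a function with controlled
  -- moments.
  have hpt (m : ℕ) : |f m - f (truncate B m)| ≤ c * (1 / 2) ^ B * 2 ^ m := by
    refine (abs_sub_le_of_abs_succ_sub_le hf (truncate_le B m)).trans ?_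
    rw [mul_assoc]
    refine mul_le_mul_of_nonneg_left ?_ hc
    rw [truncate_natCast]
    rcases le_total m B with h | h
    · rw [min_eq_right h, sub_self]
      positivity
    · rw [min_eq_left h]
      obtain ⟨d, rfl⟩ := Nat.exists_eq_add_of_le h
      have h2 : (d : ℝ) ≤ 2 ^ d := by exact_mod_cast Nat.lt_two_pow_self.le
      have h3 : (1 / 2 : ℝ) ^ B * 2 ^ (B + d) = 2 ^ d := by
        rw [pow_add, ← mul_assoc, ← mul_pow]
        norm_num
      rw [h3]
      push_cast
      linarith
  have hsub : refOperator lam mu ⊤ f i - refOperator lam mu B f i =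
      refOperator lam mu ⊤ (fun m => f m - f (truncate B m)) i := by
    -- A finite-buffer step is an infinite-buffer step followed by truncation.
    have h : refOperator lam mu B f = refOperator lam mu ⊤ fun m => f (truncate B m) := by
      ext i
      simp only [refOperator_apply, truncate_top]
    rw [h, ← Pi.sub_apply, ← map_sub]
    rfl
  rw [hsub]
  refine abs_le'.2 ⟨refOperator_mono hlam hmu ⊤ (fun m => (abs_le'.1 (hpt m)).1) i, ?_⟩
  rw [← Pi.neg_apply, ← map_neg]
  exact refOperator_mono hlam hmu ⊤ (fun m => (abs_le'.1 (hpt m)).2) i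

/-- Change the buffer in the factor next to `f` first: this costs `c * (1 / 2) ^ B * exp (lam /
mu)`, and the remaining error involves `P_B f`, with constant `(1 - mu) * c`. The induction closes
because `1 + (1 - mu) / mu = 1 / mu`. -/
theorem abs_refOperator_pow_top_sub_le (hlam : lam ∈ Set.Ioo (0 : ℝ) 1)
    (hmu : mu ∈ Set.Ioo (0 : ℝ) 1) (B n : ℕ) {f : ℕ → ℝ} {c : ℝ}
    (hf : ∀ m, |f (m + 1) - f m| ≤ c) :
    |(refOperator lam mu ⊤ ^ n) f 0 - (refOperator lam mu B ^ n) f 0| ≤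
      c * (1 / 2) ^ B * Real.exp (lam / mu) / mu := by
  have hmu0 := hmu.1
  induction n generalizing f c with
  | zero =>
    have hc : 0 ≤ c := (abs_nonneg _).trans (hf 0)
    simpa using by positivity
  | succ n ih =>
    have hc : 0 ≤ c := (abs_nonneg _).trans (hf 0)
    have h1 : |(refOperator lam mu ⊤ ^ n) (refOperator lam mu ⊤ f - refOperator lam mu B f) 0| ≤
        c * (1 / 2) ^ B * Real.exp (lam / mu) := by
      have hle : (refOperator lam mu ⊤ ^ n)
          (refOperator lam mu ⊤ ((c * (1 / 2) ^ B) • fun k => (2 : ℝ) ^ k)) 0 ≤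
          c * (1 / 2) ^ B * Real.exp (lam / mu) := by
        have h2 := refOperator_pow_powers_le hlam hmu ⊤ (n + 1) (y := 2) (by norm_num)
        rw [show lam * ((2 : ℝ) - 1) / mu = lam / mu by ring] at h2
        rw [← Module.End.mul_apply, ← pow_succ, map_smul, Pi.smul_apply, smul_eq_mul]
        gcongr
      have hpt := abs_refOperator_top_sub_le hlam hmu B hf
      refine abs_le'.2 ⟨le_trans ?_ hle, le_trans ?_ hle⟩
      · exact refOperator_pow_mono hlam hmu ⊤ n (fun i => (abs_le'.1 (hpt i)).1) 0
      · rw [← Pi.neg_apply, ← map_neg]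
        exact refOperator_pow_mono hlam hmu ⊤ n (fun i => (abs_le'.1 (hpt i)).2) 0
    have h2 := ih (abs_refOperator_succ_sub_le hlam hmu B hf)
    rw [map_sub, Pi.sub_apply] at h1
    rw [pow_succ, pow_succ, Module.End.mul_apply, Module.End.mul_apply]
    refine (abs_sub_le _ ((refOperator lam mu ⊤ ^ n) (refOperator lam mu B f) 0) _).trans
      ((add_le_add h1 h2).trans_eq ?_)
    field_simp
    ring

theorem availability_top_sub_le (hlam : lam ∈ Set.Ioo (0 : ℝ) 1)
    (hmu : mu ∈ Set.Ioo (0 : ℝ) 1) (B : ℕ) :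
    availability lam mu ⊤ - availability lam mu B ≤
      Real.exp (lam / mu) / mu * Real.exp (-Real.log 2 * B) := by
  rw [availability_eq hlam hmu, availability_eq hlam hmu]
  have hlim := ((tendsto_refOperator_pow_zero hlam hmu ⊤ (abs_single_succ_sub_le 0)).sub
    (tendsto_refOperator_pow_zero hlam hmu B (abs_single_succ_sub_le 0))).abs
  have h := le_of_tendsto' hlim fun n =>
    abs_refOperator_pow_top_sub_le hlam hmu B n (abs_single_succ_sub_le 0)
  -- The rate `θ = log 2` reflects the moment base `2`.
  have hexp : Real.exp (-Real.log 2 * B) = (1 / 2) ^ B := by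
    rw [mul_comm, Real.exp_nat_mul, Real.exp_neg, Real.exp_log two_pos, one_div]
  rw [hexp]
  have h' := (neg_le_abs _).trans h
  rw [one_mul] at h'
  calc _ = -(refLimit lam mu ⊤ (Pi.single 0 1) - refLimit lam mu B (Pi.single 0 1)) := by ring
    _ ≤ _ := h'
    _ = _ := by ring

end Operator

theorem theorem2 (lam mu : ℝ) (hlam : lam ∈ Set.Ioo (0 : ℝ) 1) (hmu : mu ∈ Set.Ioo (0 : ℝ) 1) :
    (∀ B : ℕ∞, 1 ≤ B → ∃! ν : ℕ → ℝ, IsRefStationary lam mu B ν) ∧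
    (∃ θ M : ℝ, 0 < θ ∧ ∀ B : ℕ, 1 ≤ B →
      0 ≤ availability lam mu ⊤ - availability lam mu (B : ℕ∞) ∧
      availability lam mu ⊤ - availability lam mu (B : ℕ∞) ≤ M * Real.exp (-θ * (B : ℝ))) ∧
    (∀ B₁ B₂ : ℕ, 1 ≤ B₁ → B₁ ≤ B₂ →
      availability lam mu (B₁ : ℕ∞) ≤ availability lam mu (B₂ : ℕ∞)) ∧
    Tendsto (fun B : ℕ => availability lam mu (B : ℕ∞)) atTop (𝓝 (availability lam mu ⊤)) := by
  have hmono := availability_mono hlam hmu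
  have hrate := availability_top_sub_le hlam hmu
  have hlog : 0 < Real.log 2 := Real.log_pos one_lt_two
  refine ⟨fun B _ => ⟨_, isRefStationary_refLimit hlam hmu B,
      fun ν hν => funext fun j => hν.eq_refLimit hlam hmu j⟩,
    ⟨Real.log 2, Real.exp (lam / mu) / mu, hlog, fun B _ =>
      ⟨sub_nonneg.2 (hmono le_top), hrate B⟩⟩,
    fun B₁ B₂ _ h => hmono (Nat.cast_le.2 h), ?_⟩
  have hdecay : Tendsto (fun B : ℕ => Real.exp (lam / mu) / mu * Real.exp (-Real.log 2 * B)) atTop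
      (𝓝 0) := by
    have h := Real.tendsto_exp_atBot.comp
      ((tendsto_natCast_atTop_atTop (R := ℝ)).const_mul_atTop_of_neg (neg_neg_of_pos hlog))
    simpa using h.const_mul (Real.exp (lam / mu) / mu)
  have h0 := squeeze_zero (fun B : ℕ => sub_nonneg.2 (hmono (le_top (a := (B : ℕ∞))))) hrate hdecay
  simpa using h0.const_sub (availability lam mu ⊤)
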